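/- Let $n\ge 2$ and let $B_n=\langle\sigma_1,\dots,\sigma_{n-1}\mid \sigma_i\sigma_j=\sigma_j\sigma_i\ (|i-j|\ge 2),\ \sigma_i\sigma_j\sigma_i=\sigma_j\sigma_i\sigma_j\ (|i-j|=1)\rangle$ be the $n$-strand braid group. Put $\delta=\sigma_{n-1}\cdots\sigma_2\sigma_1$ and $\varepsilon=\delta\sigma_1$. Equip $B_n$ with the dual Garside structure: let $B_n^+$ be the submonoid generated by the band generators $a_{ij}=(\sigma_{i-1}\cdots\sigma_{j+1})\,\sigma_j\,(\sigma_{i-1}\cdots\sigma_{j+1})^{-1}$, $1\le j<i\le n$, write $\alpha\preccurlyeq\beta$ if $\alpha^{-1}\beta\in B_n^+$, and let $$\inf(\alpha)=\max\{r\in\mathbb Z:\delta^r\preccurlyeq\alpha\},\quad \sup(\alpha)=\min\{s\in\mathbb Z:\alpha\preccurlyeq\delta^s\},\quad \operatorname{len}(\alpha)=\sup(\alpha)-\inf(\alpha).$$ For $\alpha\in B_n$ let $[\alpha]$ be its conjugacy class, $\operatorname{len}_s(\alpha)=\min\{\operatorname{len}(\beta):\beta\in[\alpha]\}$, $[\alpha]^S=\{\beta\in[\alpha]:\operatorname{len}(\beta)=\operatorname{len}_s(\alpha)\}$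 the super summit set, and $[\alpha]^{St}=\{\beta\in[\alpha]^S:\beta^m\in[\alpha^m]^S\text{ for all }m\in\mathbb Z\}$ the stable super summit set. **Proposition.** Let $k,p,q$ be integers, $d=\gcd(k,n-1)$, and suppose $(n-1)p+kq=d$. Then $f(\alpha)=\alpha^{k/d}$ and $g(\beta)=\delta^{np}\beta^q$ define maps $f:[\varepsilon^d]\to[\varepsilon^k]$ and $g:[\varepsilon^k]\to[\varepsilon^d]$ that are inverse to each other. They restrict to bijections between $[\varepsilon^d]^{St}$ and $[\varepsilon^k]^{St}$, that is, $f([\varepsilon^d]^{St})=[\varepsilon^k]^{St}$ and $g([\varepsilon^k]^{St})=[\varepsilon^d]^{St}$. The sets $[\varepsilon^d]^S$ and $[\varepsilon^k]^S$ are finite, and $$\#[\varepsilon^d]^S=\#[\varepsilon^d]^{St}=\#[\varepsilon^k]^{St}\le\#[\varepsilon^k]^S .$$ -/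

import Mathlib

noncomputable section

namespace DualBraid

/-- Artin's relations on free generators `s_0, …, s_{n-2}`, where `s_i` stands for `σ_{i+1}`. -/
def artinRels (n : ℕ) : Set (FreeGroup (Fin (n - 1))) :=
  {r | ∃ i j : Fin (n - 1), (i : ℕ) + 2 ≤ (j : ℕ) ∧
      r = (FreeGroup.of i * FreeGroup.of j) * (FreeGroup.of j * FreeGroup.of i)⁻¹} ∪
  {r | ∃ i j : Fin (n - 1), (i : ℕ) + 1 = (j : ℕ) ∧
      r = (FreeGroup.of i * FreeGroup.of j * FreeGroup.of i) *
        (FreeGroup.of j * FreeGroup.of i * FreeGroup.of j)⁻¹}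

/-- The braid group `B_n`, by Artin's presentation. -/
abbrev BraidGroup (n : ℕ) : Type := PresentedGroup (artinRels n)

/-- The classical generator `σ_i`, for `1 ≤ i ≤ n - 1` (and `1` for other, unused, indices). -/
def sigma (n i : ℕ) : BraidGroup n :=
  if h : 1 ≤ i ∧ i < n then PresentedGroup.of ⟨i - 1, by omega⟩ else 1

/-- The descending product `σ_{j+m-1} ⋯ σ_{j+1} σ_j` of `m` consecutive generators. -/
def sigmaDesc (n j : ℕ) : ℕ → BraidGroup n
  | 0 => 1
  | m + 1 => sigma n (j + m) * sigmaDesc n j m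

/-- The band generator
`a_{ij} = (σ_{i-1} ⋯ σ_{j+1}) σ_j (σ_{i-1} ⋯ σ_{j+1})⁻¹`, for `1 ≤ j < i ≤ n`. -/
def band (n i j : ℕ) : BraidGroup n :=
  sigmaDesc n (j + 1) (i - 1 - j) * sigma n j * (sigmaDesc n (j + 1) (i - 1 - j))⁻¹

/-- The monoid `B_n^+` of braids represented by positive words in the band generators. -/
def positiveMonoid (n : ℕ) : Submonoid (BraidGroup n) :=
  Submonoid.closure {x | ∃ i j : ℕ, 1 ≤ j ∧ j < i ∧ i ≤ n ∧ x = band n i j}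

/-- The dual Garside element `δ = σ_{n-1} ⋯ σ_2 σ_1`. -/
def delta (n : ℕ) : BraidGroup n := sigmaDesc n 1 (n - 1)

/-- The braid `ε = δ σ_1`. -/
def eps (n : ℕ) : BraidGroup n := delta n * sigma n 1

/-- The prefix order `α ≼ β`, that is, `α⁻¹ β ∈ B_n^+`. -/
def Prefix {n : ℕ} (α β : BraidGroup n) : Prop := α⁻¹ * β ∈ positiveMonoid n

/-- The infimum `inf α = max {r ∈ ℤ : δ^r ≼ α}`. -/
def infimum {n : ℕ} (α : BraidGroup n) : ℤ := sSup {r : ℤ | Prefix (delta n ^ r) α}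

/-- The supremum `sup α = min {s ∈ ℤ : α ≼ δ^s}`. -/
def supremum {n : ℕ} (α : BraidGroup n) : ℤ := sInf {s : ℤ | Prefix α (delta n ^ s)}

/-- The canonical length `len α = sup α - inf α`. -/
def len {n : ℕ} (α : BraidGroup n) : ℤ := supremum α - infimum α

/-- The conjugacy class `[α]`. -/
def conjClass {n : ℕ} (α : BraidGroup n) : Set (BraidGroup n) :=
  {β | ∃ γ : BraidGroup n, β = γ⁻¹ * α * γ}

/-- The minimal canonical length `len_s α` in the conjugacy class of `α`. -/
def lenS {n : ℕ} (α : BraidGroup n) : ℤ := sInf (len '' conjClass α)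

/-- The super summit set `[α]^S`. -/
def superSummit {n : ℕ} (α : BraidGroup n) : Set (BraidGroup n) :=
  {β | β ∈ conjClass α ∧ len β = lenS α}

/-- The stable super summit set `[α]^{St}`. -/
def stableSuperSummit {n : ℕ} (α : BraidGroup n) : Set (BraidGroup n) :=
  {β | β ∈ superSummit α ∧ ∀ m : ℤ, β ^ m ∈ superSummit (α ^ m)}

/-- The map `α ↦ α^{k/d}`; here `d` divides `k`, so the integer division is exact. -/
def fMap {n : ℕ} (k d : ℤ) (α : BraidGroup n) : BraidGroup n := α ^ (k / d)

/-- The map `β ↦ δ^{np} β^q`. -/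
def gMap {n : ℕ} (p q : ℤ) (β : BraidGroup n) : BraidGroup n :=
  delta n ^ ((n : ℤ) * p) * β ^ q

end DualBraid

end

/-! The braid `δ^n = ε^(n-1)` is central. Hence `(n-1)p + kq = d` gives `ε^d = δ^(np) (ε^k)^q`,
while `ε^k = (ε^d)^(k/d)`: each of `f`, `g` is a power map up to a central factor, commutes with
conjugation, and undoes the other on conjugates. A central factor `δ^(nj)` shifts `inf` and `sup`
equally, so it preserves length and super summit sets; as all powers of `f(β)` and `g(β)` are powers
of `β` up to such factors, stability is transported both ways.

The remaining point is that every super summit element of `ε^d` is stable when `d` divides `n-1`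
(`superSummit_eps_eq_stable`). Such an element has length at most 1, and its exponent sum `nd` then
forces it to be divisible by `δ^d`. This makes all its powers have length at most 1, and a conjugate
of a power can have length 0 only if that power is central (`zpow_mem_superSummit`).

No normal forms are needed: conjugation by `δ` preserves the positive monoid, and exponent sums
supply every bound, including finiteness. -/

namespace DualBraid

/-! ### Conjugation by `δ` on band generators. -/

section Relations

variable {n : ℕ}

theorem sigma_of_bounds {i : ℕ} (h : 1 ≤ i ∧ i < n) :
    sigma n i = PresentedGroup.of ⟨i - 1, by omega⟩ := dif_pos h

theorem sigma_eq_one {i : ℕ} (h : ¬(1 ≤ i ∧ i < n)) : sigma n i = 1 := dif_neg h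

theorem sigma_commute {i j : ℕ} (hij : i + 2 ≤ j) : Commute (sigma n i) (sigma n j) := by
  by_cases hi : 1 ≤ i ∧ i < n
  · by_cases hj : 1 ≤ j ∧ j < n
    · rw [sigma_of_bounds hi, sigma_of_bounds hj]
      have := PresentedGroup.one_of_mem (rels := artinRels n)
        (x := (FreeGroup.of ⟨i - 1, by omega⟩ * FreeGroup.of ⟨j - 1, by omega⟩) *
          (FreeGroup.of ⟨j - 1, by omega⟩ * FreeGroup.of ⟨i - 1, by omega⟩)⁻¹)
        (Or.inl ⟨⟨i - 1, by omega⟩, ⟨j - 1, by omega⟩, by simp only; omega, rfl⟩)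
      rw [map_mul, map_inv, mul_inv_eq_one] at this
      simpa [Commute, SemiconjBy, PresentedGroup.of] using this
    · rw [sigma_eq_one hj]; exact Commute.one_right _
  · rw [sigma_eq_one hi]; exact Commute.one_left _

theorem sigma_braid {i : ℕ} (h1 : 1 ≤ i) (h2 : i + 1 < n) :
    sigma n i * sigma n (i + 1) * sigma n i =
      sigma n (i + 1) * sigma n i * sigma n (i + 1) := by
  rw [sigma_of_bounds (i := i) ⟨h1, by omega⟩, sigma_of_bounds (i := i + 1) ⟨by omega, h2⟩]
  have := PresentedGroup.one_of_mem (rels := artinRels n)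
    (x := (FreeGroup.of ⟨i - 1, by omega⟩ * FreeGroup.of ⟨i + 1 - 1, by omega⟩ *
        FreeGroup.of ⟨i - 1, by omega⟩) *
      (FreeGroup.of ⟨i + 1 - 1, by omega⟩ * FreeGroup.of ⟨i - 1, by omega⟩ *
        FreeGroup.of ⟨i + 1 - 1, by omega⟩)⁻¹)
    (Or.inr ⟨⟨i - 1, by omega⟩, ⟨i + 1 - 1, by omega⟩, by simp only; omega, rfl⟩)
  rw [map_mul, map_inv, mul_inv_eq_one] at this
  simpa [PresentedGroup.of] using this

@[simp] theorem sigmaDesc_zero (j : ℕ) : sigmaDesc n j 0 = 1 := rfl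

theorem sigmaDesc_succ (j m : ℕ) :
    sigmaDesc n j (m + 1) = sigma n (j + m) * sigmaDesc n j m := rfl

@[simp] theorem sigmaDesc_one (j : ℕ) : sigmaDesc n j 1 = sigma n j := by
  simp [sigmaDesc_succ]

theorem sigmaDesc_add (j a b : ℕ) :
    sigmaDesc n j (a + b) = sigmaDesc n (j + a) b * sigmaDesc n j a := by
  induction b with
  | zero => simp
  | succ b ih => rw [← add_assoc, sigmaDesc_succ, ih, sigmaDesc_succ, mul_assoc, add_assoc j]

theorem sigmaDesc_commute {j m i : ℕ} (h : j + m + 1 ≤ i) :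
    Commute (sigmaDesc n j m) (sigma n i) := by
  induction m with
  | zero => exact Commute.one_left _
  | succ m ih => exact (sigma_commute (by omega)).mul_left (ih (by omega))

/-- Moving left, `σ_{i+1}` commutes past `σ_1, …, σ_{i-1}`, becomes `σ_i` by one braid relation, and
commutes past the rest. -/
theorem sigmaDesc_mul_sigma {m i : ℕ} (hi : 1 ≤ i) (him : i < m) (hm : m < n) :
    sigmaDesc n 1 m * sigma n (i + 1) = sigma n i * sigmaDesc n 1 m := by
  induction m with
  | zero => omega
  | succ m ih =>
    rcases Nat.lt_or_ge i m with h | h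
    · rw [sigmaDesc_succ, mul_assoc, ih h (by omega), ← mul_assoc, ← mul_assoc,
        (sigma_commute (n := n) (show i + 2 ≤ 1 + m by omega)).eq]
    · obtain rfl : i = m := by omega
      obtain ⟨l, rfl⟩ : ∃ l, i = l + 1 := ⟨i - 1, by omega⟩
      have hc := (sigmaDesc_commute (n := n) (show 1 + l + 1 ≤ l + 1 + 1 by omega)).eq
      have hb := sigma_braid (n := n) hi hm
      rw [sigmaDesc_succ, sigmaDesc_succ, Nat.add_comm 1 l, Nat.add_comm 1 (l + 1)]
      calc _ = sigma n (l + 1 + 1) * sigma n (l + 1) *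
              (sigmaDesc n 1 l * sigma n (l + 1 + 1)) := by group
        _ = _ := by rw [hc, ← mul_assoc, ← hb]; group

theorem sigmaDesc_mul_sigmaDesc {m j a : ℕ} (hj : 1 ≤ j) (hjm : j + a ≤ m) (hm : m < n) :
    sigmaDesc n 1 m * sigmaDesc n (j + 1) a = sigmaDesc n j a * sigmaDesc n 1 m := by
  induction a with
  | zero => simp
  | succ a ih =>
    rw [sigmaDesc_succ, sigmaDesc_succ, ← mul_assoc, show j + 1 + a = j + a + 1 by omega,
      sigmaDesc_mul_sigma (by omega) (by omega) hm, mul_assoc, ih (by omega), mul_assoc]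

theorem delta_mul_sigma {i : ℕ} (hi : 1 ≤ i) (hin : i + 1 < n) :
    delta n * sigma n (i + 1) = sigma n i * delta n :=
  sigmaDesc_mul_sigma hi (by omega) (by omega)

theorem delta_mul_sigmaDesc {j a : ℕ} (hj : 1 ≤ j) (hja : j + a < n) :
    delta n * sigmaDesc n (j + 1) a = sigmaDesc n j a * delta n :=
  sigmaDesc_mul_sigmaDesc hj (by omega) (by omega)

theorem delta_eq_mul {a b : ℕ} (h : a + b + 1 = n) :
    delta n = sigmaDesc n (1 + a) b * sigmaDesc n 1 a := by
  rw [delta, ← sigmaDesc_add]; congr 1; omega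

theorem band_succ (j a : ℕ) :
    band n (j + a + 1) j = sigmaDesc n j (a + 1) * (sigmaDesc n (j + 1) a)⁻¹ := by
  rw [band, show j + a + 1 - 1 - j = a by omega, Nat.add_comm a 1, sigmaDesc_add, sigmaDesc_one]

theorem band_add_two_one {a : ℕ} (h : a + 1 < n) :
    band n (a + 2) 1 = (sigmaDesc n 1 a)⁻¹ * sigmaDesc n 1 (a + 1) := by
  rw [show a + 2 = 1 + a + 1 by omega, band_succ, mul_inv_eq_iff_eq_mul, mul_assoc,
    eq_inv_mul_iff_mul_eq,
    sigmaDesc_mul_sigmaDesc le_rfl (by omega) h]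

theorem delta_mul_band_succ {i j : ℕ} (hj : 1 ≤ j) (hji : j < i) (hi : i < n) :
    delta n * band n (i + 1) (j + 1) = band n i j * delta n := by
  obtain ⟨a, rfl⟩ : ∃ a, i = j + a + 1 := ⟨i - j - 1, by omega⟩
  have h1 := delta_mul_sigmaDesc (n := n) (j := j) (a := a + 1) hj (by omega)
  have h2 := delta_mul_sigmaDesc (n := n) (j := j + 1) (a := a) (by omega) (by omega)
  rw [show j + a + 1 + 1 = (j + 1) + a + 1 by omega, band_succ, band_succ, ← mul_assoc, h1,
    mul_assoc, mul_assoc]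
  congr 1
  rw [mul_inv_eq_iff_eq_mul, mul_assoc, eq_inv_mul_iff_mul_eq, h2]

/-- The wrap-around case of the index shift: splitting `δ` just below `σ_j` on the left and just
above it on the right cancels the inverses in both bands, leaving the same product. -/
theorem delta_mul_band_one {j : ℕ} (hj : 1 ≤ j) (hjn : j < n) :
    delta n * band n (j + 1) 1 = band n n j * delta n := by
  obtain ⟨b, rfl⟩ : ∃ b, n = j + b + 1 := ⟨n - j - 1, by omega⟩
  obtain ⟨l, rfl⟩ : ∃ l, j = l + 1 := ⟨j - 1, by omega⟩
  rw [band_succ, show l + 1 + 1 = l + 2 from rfl, band_add_two_one (by omega)]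
  have h1 := delta_eq_mul (n := l + 1 + b + 1) (a := l) (b := b + 1) (by omega)
  have h2 := delta_eq_mul (n := l + 1 + b + 1) (a := l + 1) (b := b) (by omega)
  rw [Nat.add_comm 1 l] at h1
  rw [show 1 + (l + 1) = l + 2 by omega] at h2
  conv_lhs => rw [h1]
  rw [h2]
  group

end Relations

/-! ### Centrality of `δ^n` and the identity `ε^(n-1) = δ^n`. -/

section Center

variable {n : ℕ}

theorem band_succ_self (j : ℕ) : band n (j + 1) j = sigma n j := by
  simpa using band_succ (n := n) j 0

/-- Two wrap-arounds: `σ_1 = a_{21}` goes to `a_{n1}`, then to `a_{n,n-1} = σ_{n-1}`. -/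
theorem delta_sq_mul_sigma_one (hn : 2 ≤ n) :
    delta n ^ 2 * sigma n 1 = sigma n (n - 1) * delta n ^ 2 := by
  have h1 := delta_mul_band_one (n := n) (j := 1) le_rfl (by omega)
  have h2 := delta_mul_band_one (n := n) (j := n - 1) (by omega) (by omega)
  have h3 : band n n (n - 1) = sigma n (n - 1) := by
    have h := band_succ_self (n := n) (n - 1)
    rwa [show n - 1 + 1 = n by omega] at h
  rw [show n - 1 + 1 = n by omega, h3] at h2
  rw [band_succ_self] at h1
  rw [pow_two, mul_assoc, h1, ← mul_assoc, h2, mul_assoc]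

theorem delta_pow_mul_sigma {a i : ℕ} (hi : 1 ≤ i) (h : i + a < n) :
    delta n ^ a * sigma n (i + a) = sigma n i * delta n ^ a := by
  induction a with
  | zero => simp
  | succ a ih =>
    rw [pow_succ, mul_assoc, ← add_assoc, delta_mul_sigma (by omega) (by omega), ← mul_assoc,
      ih (by omega), mul_assoc]

theorem delta_pow_commute_sigma (hn : 2 ≤ n) (i : ℕ) : Commute (delta n ^ n) (sigma n i) := by
  by_cases h : 1 ≤ i ∧ i < n
  swap
  · rw [sigma_eq_one h]; exact Commute.one_right _
  obtain ⟨hi, hin⟩ := h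
  have h1 := delta_pow_mul_sigma (n := n) (i := 1) (a := i - 1) le_rfl (by omega)
  have h2 := delta_pow_mul_sigma (n := n) (i := i) (a := n - 1 - i) hi (by omega)
  have h3 := delta_sq_mul_sigma_one hn
  rw [show 1 + (i - 1) = i by omega] at h1
  rw [show i + (n - 1 - i) = n - 1 by omega] at h2
  -- Conjugation takes `σ_i` down to `σ_1`, around to `σ_{n-1}`, and down to `σ_i` again, in `n`
  -- steps altogether.
  have e : delta n ^ n = delta n ^ (n - 1 - i) * delta n ^ 2 * delta n ^ (i - 1) := by
    rw [← pow_add, ← pow_add]; congr 1; omega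
  change _ = _
  rw [e, mul_assoc, h1, ← mul_assoc, mul_assoc (delta n ^ (n - 1 - i)), h3, ← mul_assoc, h2]
  group

theorem closure_sigma : Subgroup.closure (Set.range (sigma n)) = ⊤ := by
  rw [eq_top_iff, ← PresentedGroup.closure_range_of (artinRels n)]
  refine Subgroup.closure_mono ?_
  rintro _ ⟨i, rfl⟩
  exact ⟨i + 1, by rw [sigma_of_bounds ⟨by omega, by omega⟩]; rfl⟩

theorem delta_pow_commute (hn : 2 ≤ n) (x : BraidGroup n) : Commute (delta n ^ n) x := by
  have hx : x ∈ Subgroup.closure (Set.range (sigma n)) := by rw [closure_sigma]; trivial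
  induction hx using Subgroup.closure_induction with
  | mem x hx => obtain ⟨i, rfl⟩ := hx; exact delta_pow_commute_sigma hn i
  | one => exact Commute.one_right _
  | mul x y _ _ hx hy => exact hx.mul_right hy
  | inv x _ hx => exact hx.inv_right

/-- Moving the `δ` of a new factor `δσ_1` left across `σ_m ⋯ σ_1` raises its indices by one, and the
new `σ_1` completes the product. -/
theorem eps_pow_eq {m : ℕ} (hm : m < n) : eps n ^ m = delta n ^ m * sigmaDesc n 1 m := by
  induction m with
  | zero => simp
  | succ m ih =>
    have h := delta_mul_sigmaDesc (n := n) (j := 1) (a := m) le_rfl (by omega)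
    rw [pow_succ, ih (by omega), eps, Nat.add_comm m 1, sigmaDesc_add, sigmaDesc_one,
      ← mul_assoc, mul_assoc (delta n ^ m), ← h, Nat.add_comm 1 m, pow_succ]
    group

theorem eps_pow_pred (hn : 2 ≤ n) : eps n ^ (n - 1) = delta n ^ n := by
  rw [eps_pow_eq (by omega), ← delta, ← pow_succ]; congr 1; omega

end Center

/-! ### Exponent sum. -/

section ExponentSum

variable {n : ℕ}

/-- The homomorphism `B_n → ℤ` sending every `σ_i` to `1`. -/
def exponentHom (n : ℕ) : BraidGroup n →* Multiplicative ℤ :=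
  PresentedGroup.toGroup (f := fun _ => Multiplicative.ofAdd (1 : ℤ)) (by
    rintro r (⟨i, j, -, rfl⟩ | ⟨i, j, -, rfl⟩) <;> simp)

/-- The exponent sum of a braid. -/
def exponentSum (x : BraidGroup n) : ℤ := Multiplicative.toAdd (exponentHom n x)

@[simp] theorem exponentSum_one : exponentSum (1 : BraidGroup n) = 0 := by simp [exponentSum]

@[simp] theorem exponentSum_mul (x y : BraidGroup n) :
    exponentSum (x * y) = exponentSum x + exponentSum y := by simp [exponentSum]

@[simp] theorem exponentSum_inv (x : BraidGroup n) : exponentSum x⁻¹ = -exponentSum x := by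
  simp [exponentSum]

@[simp] theorem exponentSum_zpow (x : BraidGroup n) (m : ℤ) :
    exponentSum (x ^ m) = m * exponentSum x := by simp [exponentSum]

theorem exponentSum_sigma {i : ℕ} (h1 : 1 ≤ i) (h2 : i < n) : exponentSum (sigma n i) = 1 := by
  rw [sigma_of_bounds ⟨h1, h2⟩]
  simp [exponentSum, exponentHom]

theorem exponentSum_sigmaDesc {j m : ℕ} (hj : 1 ≤ j) (h : j + m ≤ n) :
    exponentSum (sigmaDesc n j m) = m := by
  induction m with
  | zero => simp
  | succ m ih =>
    rw [sigmaDesc_succ, exponentSum_mul, ih (by omega), exponentSum_sigma (by omega) (by omega)]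
    push_cast; ring

theorem exponentSum_delta (hn : 2 ≤ n) : exponentSum (delta n) = (n : ℤ) - 1 := by
  rw [delta, exponentSum_sigmaDesc le_rfl (by omega)]; omega

theorem exponentSum_eps (hn : 2 ≤ n) : exponentSum (eps n) = n := by
  rw [eps, exponentSum_mul, exponentSum_delta hn, exponentSum_sigma le_rfl (by omega)]; ring

theorem exponentSum_band {i j : ℕ} (hj : 1 ≤ j) (hji : j < i) (hi : i ≤ n) :
    exponentSum (band n i j) = 1 := by
  rw [band, exponentSum_mul, exponentSum_mul, exponentSum_inv, exponentSum_sigma hj (by omega)]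
  ring

theorem exponentSum_of_mem_conjClass {α β : BraidGroup n} (h : β ∈ conjClass α) :
    exponentSum β = exponentSum α := by
  obtain ⟨γ, rfl⟩ := h
  rw [exponentSum_mul, exponentSum_mul, exponentSum_inv]; ring

theorem exponentSum_nonneg {x : BraidGroup n} (hx : x ∈ positiveMonoid n) :
    0 ≤ exponentSum x := by
  induction hx using Submonoid.closure_induction with
  | mem x hx =>
    obtain ⟨i, j, hj, hji, hi, rfl⟩ := hx
    rw [exponentSum_band hj hji hi]; exact zero_le_one
  | one => simp
  | mul x y _ _ hx hy => rw [exponentSum_mul]; exact add_nonneg hx hy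

end ExponentSum

/-! ### The positive monoid and divisibility by powers of `δ`. -/

section Positive

variable {n : ℕ}

theorem band_mem_positiveMonoid {i j : ℕ} (hj : 1 ≤ j) (hji : j < i) (hi : i ≤ n) :
    band n i j ∈ positiveMonoid n :=
  Submonoid.subset_closure ⟨i, j, hj, hji, hi, rfl⟩

theorem sigma_mem_positiveMonoid (i : ℕ) : sigma n i ∈ positiveMonoid n := by
  by_cases h : 1 ≤ i ∧ i < n
  · rw [← band_succ_self]
    exact band_mem_positiveMonoid h.1 (by omega) (by omega)
  · rw [sigma_eq_one h]; exact one_mem _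

theorem sigmaDesc_mem_positiveMonoid (j m : ℕ) : sigmaDesc n j m ∈ positiveMonoid n := by
  induction m with
  | zero => exact one_mem _
  | succ m ih => exact mul_mem (sigma_mem_positiveMonoid _) ih

theorem delta_mem_positiveMonoid : delta n ∈ positiveMonoid n := sigmaDesc_mem_positiveMonoid _ _

theorem delta_conj_mem {x : BraidGroup n} (hx : x ∈ positiveMonoid n) :
    delta n * x * (delta n)⁻¹ ∈ positiveMonoid n := by
  induction hx using Submonoid.closure_induction with
  | mem x hx =>
    obtain ⟨i, j, hj, hji, hi, rfl⟩ := hx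
    obtain ⟨i, rfl⟩ : ∃ l, i = l + 1 := ⟨i - 1, by omega⟩
    rcases hj.eq_or_lt with rfl | hj
    · rw [delta_mul_band_one (by omega) (by omega), mul_inv_cancel_right]
      exact band_mem_positiveMonoid (by omega) (by omega) le_rfl
    · obtain ⟨j, rfl⟩ : ∃ l, j = l + 1 := ⟨j - 1, by omega⟩
      rw [delta_mul_band_succ (by omega) (by omega) (by omega), mul_inv_cancel_right]
      exact band_mem_positiveMonoid (by omega) (by omega) (by omega)
  | one => simp
  | mul x y _ _ hx hy => simpa [mul_assoc] using mul_mem hx hy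

theorem delta_conj_inv_mem {x : BraidGroup n} (hx : x ∈ positiveMonoid n) :
    (delta n)⁻¹ * x * delta n ∈ positiveMonoid n := by
  induction hx using Submonoid.closure_induction with
  | mem x hx =>
    obtain ⟨i, j, hj, hji, hi, rfl⟩ := hx
    rw [mul_assoc]
    rcases hi.eq_or_lt with rfl | hi
    · rw [← delta_mul_band_one hj hji, inv_mul_cancel_left]
      exact band_mem_positiveMonoid le_rfl (by omega) (by omega)
    · rw [← delta_mul_band_succ hj hji hi, inv_mul_cancel_left]
      exact band_mem_positiveMonoid (by omega) (by omega) (by omega)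
  | one => simp
  | mul x y _ _ hx hy => simpa [mul_assoc] using mul_mem hx hy

theorem delta_zpow_conj_mem {x : BraidGroup n} (hx : x ∈ positiveMonoid n) (r : ℤ) :
    delta n ^ r * x * delta n ^ (-r) ∈ positiveMonoid n := by
  induction r using Int.induction_on with
  | zero => simpa using hx
  | succ r ih =>
    have := delta_conj_mem ih
    convert this using 1
    rw [add_comm (r : ℤ) 1, zpow_add, neg_add_rev, zpow_add]
    group
  | pred r ih =>
    have := delta_conj_inv_mem ih
    convert this using 1
    rw [sub_eq_neg_add, zpow_add, neg_add_rev, zpow_add]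
    group

theorem Prefix.trans {α β γ : BraidGroup n} (h₁ : Prefix α β) (h₂ : Prefix β γ) : Prefix α γ := by
  have := mul_mem h₁ h₂
  rwa [mul_assoc, mul_inv_cancel_left] at this

theorem delta_zpow_prefix_delta_zpow {r s : ℤ} (h : r ≤ s) :
    Prefix (delta n ^ r) (delta n ^ s) := by
  obtain ⟨t, rfl⟩ := Int.le.dest h
  change _ ∈ _
  rw [← zpow_neg, ← zpow_add, neg_add_cancel_left, zpow_natCast]
  exact pow_mem delta_mem_positiveMonoid t

theorem Prefix.delta_mul {r s : ℤ} {α β : BraidGroup n} (h₁ : Prefix (delta n ^ r) α)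
    (h₂ : Prefix (delta n ^ s) β) : Prefix (delta n ^ (r + s)) (α * β) := by
  have := mul_mem (delta_zpow_conj_mem h₁ (-s)) h₂
  change _ ∈ _
  convert this using 1
  rw [zpow_add, neg_neg, zpow_neg]
  group

theorem prefix_delta_zpow_iff {s : ℤ} {α : BraidGroup n} :
    Prefix α (delta n ^ s) ↔ Prefix (delta n ^ (-s)) α⁻¹ := by
  constructor
  · intro h
    have := delta_zpow_conj_mem h s
    change _ ∈ _
    convert this using 1
    rw [zpow_neg]; group
  · intro h
    have := delta_zpow_conj_mem h (-s)
    change _ ∈ _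
    convert this using 1
    rw [zpow_neg]; group

theorem exists_delta_zpow_prefix (x : BraidGroup n) : ∃ r : ℤ, Prefix (delta n ^ r) x := by
  have hx : x ∈ Subgroup.closure (Set.range (sigma n)) := by rw [closure_sigma]; trivial
  induction hx using Subgroup.closure_induction'' with
  | mem x hx =>
    obtain ⟨i, rfl⟩ := hx
    exact ⟨0, by simpa [Prefix] using sigma_mem_positiveMonoid i⟩
  | inv_mem x hx =>
    obtain ⟨i, rfl⟩ := hx
    by_cases h : 1 ≤ i ∧ i < n
    swap
    · exact ⟨0, by simp [Prefix, sigma_eq_one h]⟩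
    refine ⟨-1, prefix_delta_zpow_iff.1 ?_⟩
    obtain ⟨a, rfl⟩ : ∃ a, i = 1 + a := ⟨i - 1, by omega⟩
    -- Writing `δ = U σ_i V` gives `σ_i⁻¹ δ = V (δ⁻¹ U δ)`, which is positive.
    have hd := delta_eq_mul (n := n) (a := a + 1) (b := n - 2 - a) (by omega)
    rw [sigmaDesc_succ] at hd
    have := mul_mem (sigmaDesc_mem_positiveMonoid (n := n) 1 a)
      (delta_conj_inv_mem (sigmaDesc_mem_positiveMonoid (n := n) (1 + (a + 1)) (n - 2 - a)))
    change _ ∈ _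
    convert this using 1
    rw [hd]; group
  | one => exact ⟨0, by simp [Prefix]⟩
  | mul x y _ _ hx hy =>
    obtain ⟨r, hr⟩ := hx
    obtain ⟨s, hs⟩ := hy
    exact ⟨r + s, hr.delta_mul hs⟩

end Positive

/-! ### Infimum, supremum and their exponent sum bounds. -/

section InfSup

variable {n : ℕ}

theorem Prefix.le_exponentSum (hn : 2 ≤ n) {r : ℤ} {α : BraidGroup n}
    (h : Prefix (delta n ^ r) α) : r * ((n : ℤ) - 1) ≤ exponentSum α := by
  have := exponentSum_nonneg h
  rw [exponentSum_mul, exponentSum_inv, exponentSum_zpow, exponentSum_delta hn] at this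
  linarith

theorem Prefix.exponentSum_le (hn : 2 ≤ n) {s : ℤ} {α : BraidGroup n}
    (h : Prefix α (delta n ^ s)) : exponentSum α ≤ s * ((n : ℤ) - 1) := by
  have := exponentSum_nonneg h
  rw [exponentSum_mul, exponentSum_inv, exponentSum_zpow, exponentSum_delta hn] at this
  linarith

/-- The exponent sum bounds the set of admissible `r` above, so `sSup` is a true maximum and not the
default value. -/
theorem prefix_infimum (hn : 2 ≤ n) (α : BraidGroup n) : Prefix (delta n ^ infimum α) α := by
  refine Int.csSup_mem (s := {r : ℤ | Prefix (delta n ^ r) α}) (exists_delta_zpow_prefix α) ?_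
  refine ⟨|exponentSum α|, fun r hr => ?_⟩
  have := Prefix.le_exponentSum hn hr
  have hn' : (2 : ℤ) ≤ n := by exact_mod_cast hn
  by_contra! hlt
  nlinarith [abs_nonneg (exponentSum α), le_abs_self (exponentSum α)]

theorem prefix_iff_le_infimum (hn : 2 ≤ n) {r : ℤ} {α : BraidGroup n} :
    Prefix (delta n ^ r) α ↔ r ≤ infimum α := by
  refine ⟨fun h => le_csSup ?_ h, fun h => (delta_zpow_prefix_delta_zpow h).trans
    (prefix_infimum hn α)⟩
  refine ⟨|exponentSum α|, fun r hr => ?_⟩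
  have := Prefix.le_exponentSum hn hr
  have hn' : (2 : ℤ) ≤ n := by exact_mod_cast hn
  by_contra! hlt
  nlinarith [abs_nonneg (exponentSum α), le_abs_self (exponentSum α)]

theorem supremum_eq_neg_infimum_inv (hn : 2 ≤ n) (α : BraidGroup n) :
    supremum α = -infimum α⁻¹ := by
  refine IsLeast.csInf_eq ⟨prefix_delta_zpow_iff.2 ?_, fun s hs => ?_⟩
  · rw [neg_neg]; exact prefix_infimum hn _
  · exact neg_le.1 ((prefix_iff_le_infimum hn).1 (prefix_delta_zpow_iff.1 hs))

theorem prefix_iff_supremum_le (hn : 2 ≤ n) {s : ℤ} {α : BraidGroup n} :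
    Prefix α (delta n ^ s) ↔ supremum α ≤ s := by
  rw [supremum_eq_neg_infimum_inv hn, prefix_delta_zpow_iff, prefix_iff_le_infimum hn]
  omega

theorem infimum_le_exponentSum (hn : 2 ≤ n) (α : BraidGroup n) :
    infimum α * ((n : ℤ) - 1) ≤ exponentSum α :=
  Prefix.le_exponentSum hn (prefix_infimum hn α)

theorem exponentSum_le_supremum (hn : 2 ≤ n) (α : BraidGroup n) :
    exponentSum α ≤ supremum α * ((n : ℤ) - 1) :=
  Prefix.exponentSum_le hn ((prefix_iff_supremum_le hn).2 le_rfl)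

theorem len_nonneg (hn : 2 ≤ n) (α : BraidGroup n) : 0 ≤ len α := by
  have h := (infimum_le_exponentSum hn α).trans (exponentSum_le_supremum hn α)
  exact sub_nonneg.2 (le_of_mul_le_mul_right h (by omega))

theorem len_le_of_prefix (hn : 2 ≤ n) {r s : ℤ} {α : BraidGroup n}
    (h₁ : Prefix (delta n ^ r) α) (h₂ : Prefix α (delta n ^ s)) : len α ≤ s - r :=
  sub_le_sub ((prefix_iff_supremum_le hn).1 h₂) ((prefix_iff_le_infimum hn).1 h₁)

theorem dvd_exponentSum_of_len_eq_zero (hn : 2 ≤ n) {α : BraidGroup n} (h : len α = 0) :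
    (n : ℤ) - 1 ∣ exponentSum α := by
  have h₁ := infimum_le_exponentSum hn α
  have h₂ := exponentSum_le_supremum hn α
  rw [sub_eq_zero.1 h] at h₂
  exact ⟨infimum α, by rw [mul_comm]; exact le_antisymm h₂ h₁⟩

theorem infimum_delta_zpow_mul (hn : 2 ≤ n) (r : ℤ) (α : BraidGroup n) :
    infimum (delta n ^ r * α) = r + infimum α := by
  have key : ∀ s, s ≤ infimum (delta n ^ r * α) ↔ s ≤ r + infimum α := fun s => by
    rw [← prefix_iff_le_infimum hn, ← sub_le_iff_le_add', ← prefix_iff_le_infimum hn, Prefix,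
      Prefix, sub_eq_neg_add, zpow_add, zpow_neg, mul_inv_rev, inv_inv, mul_assoc]
  exact le_antisymm ((key _).1 le_rfl) ((key _).2 le_rfl)

end InfSup

/-! ### Super summit sets: central shifts and finiteness. -/

section SuperSummit

variable {n : ℕ}

theorem mem_conjClass_self (α : BraidGroup n) : α ∈ conjClass α := ⟨1, by simp⟩

theorem zpow_mem_conjClass {α β : BraidGroup n} (h : β ∈ conjClass α) (m : ℤ) :
    β ^ m ∈ conjClass (α ^ m) := by
  obtain ⟨γ, rfl⟩ := h
  exact ⟨γ, by simpa using conj_zpow (i := m) (a := γ⁻¹) (b := α)⟩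

theorem delta_zpow_commute (hn : 2 ≤ n) (j : ℤ) (x : BraidGroup n) :
    Commute (delta n ^ ((n : ℤ) * j)) x := by
  rw [zpow_mul, zpow_natCast]
  exact (delta_pow_commute hn x).zpow_left j

theorem len_delta_zpow_mul (hn : 2 ≤ n) (j : ℤ) (α : BraidGroup n) :
    len (delta n ^ ((n : ℤ) * j) * α) = len α := by
  have h : (delta n ^ ((n : ℤ) * j) * α)⁻¹ = delta n ^ (-((n : ℤ) * j)) * α⁻¹ := by
    rw [(delta_zpow_commute hn j α).eq, mul_inv_rev, zpow_neg]
  rw [len, len, supremum_eq_neg_infimum_inv hn, supremum_eq_neg_infimum_inv hn, h,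
    infimum_delta_zpow_mul hn, infimum_delta_zpow_mul hn]
  ring

theorem delta_zpow_mul_mem_conjClass (hn : 2 ≤ n) (j : ℤ) {α β : BraidGroup n}
    (h : β ∈ conjClass α) :
    delta n ^ ((n : ℤ) * j) * β ∈ conjClass (delta n ^ ((n : ℤ) * j) * α) := by
  obtain ⟨γ, rfl⟩ := h
  refine ⟨γ, ?_⟩
  rw [← mul_assoc, ← mul_assoc, ← mul_assoc, (delta_zpow_commute hn j γ⁻¹).eq]

theorem lenS_le (hn : 2 ≤ n) {α β : BraidGroup n} (h : β ∈ conjClass α) : lenS α ≤ len β :=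
  csInf_le ⟨0, by rintro _ ⟨x, -, rfl⟩; exact len_nonneg hn x⟩ ⟨β, h, rfl⟩

theorem exists_len_eq_lenS (hn : 2 ≤ n) (α : BraidGroup n) :
    ∃ β ∈ conjClass α, len β = lenS α :=
  Int.csInf_mem (s := len '' conjClass α) ⟨_, α, mem_conjClass_self α, rfl⟩
    ⟨0, by rintro _ ⟨x, -, rfl⟩; exact len_nonneg hn x⟩

theorem mem_superSummit_iff (hn : 2 ≤ n) {α β : BraidGroup n} :
    β ∈ superSummit α ↔ β ∈ conjClass α ∧ ∀ γ ∈ conjClass α, len β ≤ len γ := by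
  refine ⟨fun h => ⟨h.1, fun γ hγ => h.2.trans_le (lenS_le hn hγ)⟩, fun h => ⟨h.1, ?_⟩⟩
  obtain ⟨γ, hγ, e⟩ := exists_len_eq_lenS hn α
  exact le_antisymm ((h.2 γ hγ).trans_eq e) (lenS_le hn h.1)

theorem delta_zpow_mul_mem_superSummit (hn : 2 ≤ n) (j : ℤ) {α β : BraidGroup n}
    (h : β ∈ superSummit α) :
    delta n ^ ((n : ℤ) * j) * β ∈ superSummit (delta n ^ ((n : ℤ) * j) * α) := by
  rw [mem_superSummit_iff hn] at h ⊢
  refine ⟨delta_zpow_mul_mem_conjClass hn j h.1, fun γ hγ => ?_⟩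
  have h' := h.2 (delta n ^ ((n : ℤ) * -j) * γ) (by
    simpa [← mul_assoc, ← zpow_add] using delta_zpow_mul_mem_conjClass hn (-j) hγ)
  rwa [len_delta_zpow_mul hn, ← len_delta_zpow_mul hn (-j) γ]

open scoped Pointwise in
theorem finite_positive_exponentSum (c : ℤ) :
    {x : BraidGroup n | x ∈ positiveMonoid n ∧ exponentSum x ≤ c}.Finite := by
  have hfin : {x : BraidGroup n | ∃ i j : ℕ, 1 ≤ j ∧ j < i ∧ i ≤ n ∧ x = band n i j}.Finite := by
    refine ((Set.finite_Iic n).prod (Set.finite_Iic n)).image (fun t => band n t.1 t.2)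
      |>.subset ?_
    rintro _ ⟨i, j, hj, hji, hi, rfl⟩
    exact ⟨(i, j), ⟨hi, by simp; omega⟩, rfl⟩
  -- A positive braid is a product of exactly as many bands as its exponent sum; inserting `1` makes
  -- the powers increasing, so one power covers all shorter products.
  have hpow : ∀ m : ℕ, ((insert 1 {x : BraidGroup n |
      ∃ i j : ℕ, 1 ≤ j ∧ j < i ∧ i ≤ n ∧ x = band n i j}) ^ m : Set (BraidGroup n)).Finite :=
    fun m => by
      induction m with
      | zero => rw [pow_zero]; exact Set.finite_one
      | succ m ih => rw [pow_succ]; exact ih.mul (hfin.insert 1)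
  refine (hpow c.toNat).subset ?_
  rintro x ⟨hx, hc⟩
  suffices h : ∃ m : ℕ, (m : ℤ) = exponentSum x ∧ x ∈ ((insert 1 {x : BraidGroup n |
      ∃ i j : ℕ, 1 ≤ j ∧ j < i ∧ i ≤ n ∧ x = band n i j}) ^ m : Set (BraidGroup n)) by
    obtain ⟨m, hm, hx⟩ := h
    exact Set.pow_subset_pow_right (Set.mem_insert _ _) (by omega) hx
  clear hc
  induction hx using Submonoid.closure_induction with
  | mem x hx =>
    refine ⟨1, ?_, by rw [pow_one]; exact Or.inr hx⟩
    obtain ⟨i, j, hj, hji, hi, rfl⟩ := hx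
    rw [exponentSum_band hj hji hi]; rfl
  | one => exact ⟨0, by simp, by simp⟩
  | mul x y _ _ hx hy =>
    obtain ⟨a, ha, hx⟩ := hx
    obtain ⟨b, hb, hy⟩ := hy
    exact ⟨a + b, by rw [exponentSum_mul]; omega, by rw [pow_add]; exact Set.mul_mem_mul hx hy⟩

theorem superSummit_finite (hn : 2 ≤ n) (α : BraidGroup n) : (superSummit α).Finite := by
  set e := exponentSum α
  set L := lenS α
  have hn' : (2 : ℤ) ≤ n := by exact_mod_cast hn
  -- On the class the exponent sum is `e`, so `sup ≥ -|e|`, and length `L` gives `inf ≥ -|e| - L`.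
  set r : ℤ := -|e| - L with hr
  refine ((finite_positive_exponentSum (n := n) (e - r * ((n : ℤ) - 1))).image
    (fun x => delta n ^ r * x)).subset ?_
  rintro β ⟨hβ, hlen⟩
  have he := exponentSum_of_mem_conjClass hβ
  have h2 := exponentSum_le_supremum hn β
  have hle : r ≤ infimum β := by
    have hs : -|e| ≤ supremum β := by
      by_contra! hlt
      nlinarith [abs_nonneg e, neg_abs_le e]
    rw [len] at hlen
    omega
  refine ⟨(delta n ^ r)⁻¹ * β, ⟨(prefix_iff_le_infimum hn).2 hle, ?_⟩, by simp⟩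
  rw [exponentSum_mul, exponentSum_inv, exponentSum_zpow, exponentSum_delta hn, he]
  linarith

end SuperSummit

/-! ### Powers of `ε`. -/

section Periodic

variable {n : ℕ}

theorem eps_zpow_eq (hn : 2 ≤ n) (t : ℤ) :
    eps n ^ (((n : ℤ) - 1) * t) = delta n ^ ((n : ℤ) * t) := by
  rw [zpow_mul, zpow_mul, show (n : ℤ) - 1 = ((n - 1 : ℕ) : ℤ) by omega, zpow_natCast,
    zpow_natCast, eps_pow_pred hn]

theorem conjClass_eps_zpow (hn : 2 ≤ n) {t : ℤ} {β : BraidGroup n}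
    (h : β ∈ conjClass (eps n ^ (((n : ℤ) - 1) * t))) : β = delta n ^ ((n : ℤ) * t) := by
  obtain ⟨γ, rfl⟩ := h
  rw [eps_zpow_eq hn, ← (delta_zpow_commute hn t γ⁻¹).eq, inv_mul_cancel_right]

theorem delta_zpow_prefix_pow {d : ℤ} {β : BraidGroup n} (h : Prefix (delta n ^ d) β) (m : ℕ) :
    Prefix (delta n ^ (d * m)) (β ^ m) := by
  induction m with
  | zero => simp [Prefix]
  | succ m ih =>
    rw [pow_succ]
    convert ih.delta_mul h using 2
    push_cast; ring

/-- A conjugate of `ε^d`, with `d ∣ n - 1`, that is divisible by `δ^d` has all its powers in the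
super summit sets. -/
theorem zpow_mem_superSummit (hn : 2 ≤ n) {d r : ℤ} (hd : 0 < d) (hr : d * r = (n : ℤ) - 1)
    {β : BraidGroup n} (hβ : β ∈ conjClass (eps n ^ d)) (hp : Prefix (delta n ^ d) β) (m : ℤ) :
    β ^ m ∈ superSummit ((eps n ^ d) ^ m) ∧ len (β ^ m) ≤ 1 := by
  have hr0 : 0 < r := by
    have : 0 < d * r := by omega
    exact (pos_iff_pos_of_mul_pos this).1 hd
  have hc := zpow_mem_conjClass hβ m
  have hβr : β ^ r = delta n ^ (n : ℤ) := by
    have := zpow_mem_conjClass hβ r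
    rw [← zpow_mul, hr, ← mul_one ((n : ℤ) - 1)] at this
    simpa using conjClass_eps_zpow hn this
  obtain ⟨s, hs⟩ := Int.eq_ofNat_of_zero_le (Int.emod_nonneg m hr0.ne')
  have hsr : (s : ℤ) < r := hs ▸ Int.emod_lt_of_pos m hr0
  -- Since `β^r = δ^n` is central, only the residue `s` of `m` modulo `r` affects the length.
  have hm : β ^ m = delta n ^ ((n : ℤ) * (m / r)) * β ^ s := by
    conv_lhs => rw [← Int.mul_ediv_add_emod m r, zpow_add, zpow_mul, hβr, ← zpow_mul, hs,
      zpow_natCast]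
  have hlen : len (β ^ m) = len (β ^ s) := by rw [hm, len_delta_zpow_mul hn]
  rw [mem_superSummit_iff hn, hlen]
  have hle : len (β ^ s) ≤ 1 := by
    obtain ⟨u, hu⟩ := Int.eq_ofNat_of_zero_le (sub_nonneg.2 hsr.le)
    -- With `u = r - s`, `β^(-s) = β^u δ^(-n)` is divisible by `δ^(du - n)`, and `du - n = -(ds +
    -- 1)` because `dr = n - 1`.
    have h2 : Prefix (β ^ s) (delta n ^ (d * s + 1)) := by
      have h3 := (delta_zpow_prefix_pow hp u).delta_mul
        (delta_zpow_prefix_delta_zpow (n := n) (le_refl (-(n : ℤ))))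
      rw [prefix_delta_zpow_iff]
      have e1 : β ^ u * delta n ^ (-(n : ℤ)) = (β ^ s)⁻¹ := by
        rw [eq_inv_iff_mul_eq_one, zpow_neg, ← hβr, ← zpow_natCast, ← zpow_natCast, ← hu]
        group
      rw [e1] at h3
      convert h3 using 2
      rw [← hu, mul_sub, hr]; ring
    have := len_le_of_prefix hn (delta_zpow_prefix_pow hp s) h2
    omega
  refine ⟨⟨hc, fun γ hγ => ?_⟩, hle⟩
  -- Length 0 makes `n - 1` divide the exponent sum `mdn`; as `n` is prime to `n - 1 = dr`, this
  -- forces `r ∣ m`, and then `β^m` is itself a power of `δ^n`.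
  rcases (len_nonneg hn γ).eq_or_lt with h0 | h0
  · have hdvd := dvd_exponentSum_of_len_eq_zero hn h0.symm
    rw [exponentSum_of_mem_conjClass hγ, exponentSum_zpow, exponentSum_zpow,
      exponentSum_eps hn, ← mul_assoc] at hdvd
    have hcop : IsCoprime ((n : ℤ) - 1) n := ⟨-1, 1, by ring⟩
    have h1 := hcop.dvd_of_dvd_mul_right hdvd
    rw [← hr, mul_comm d r] at h1
    have h2 := Int.emod_eq_zero_of_dvd (Int.dvd_of_mul_dvd_mul_right hd.ne' h1)
    obtain rfl : s = 0 := by omega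
    have := len_delta_zpow_mul hn (m / r) (1 : BraidGroup n)
    have h4 : len (1 : BraidGroup n) ≤ 0 - 0 :=
      len_le_of_prefix hn (r := 0) (s := 0) (by simp [Prefix]) (by simp [Prefix])
    rw [pow_zero]
    omega
  · omega

theorem superSummit_eps_eq_stable (hn : 2 ≤ n) {d r : ℤ} (hd : 0 < d)
    (hr : d * r = (n : ℤ) - 1) :
    superSummit (eps n ^ d) = stableSuperSummit (eps n ^ d) := by
  refine Set.Subset.antisymm (fun β hβ => ⟨hβ, fun m => ?_⟩) fun β hβ => hβ.1
  have hε : Prefix (delta n ^ d) (eps n ^ d) := by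
    obtain ⟨m, rfl⟩ := Int.eq_ofNat_of_zero_le hd.le
    have : Prefix (delta n ^ (1 : ℤ)) (eps n) := by
      simpa [Prefix, eps] using sigma_mem_positiveMonoid 1
    simpa using delta_zpow_prefix_pow this m
  have h1 := (zpow_mem_superSummit hn hd hr (mem_conjClass_self _) hε 1).2
  rw [zpow_one] at h1
  have h2 : len β ≤ 1 := hβ.2.trans_le ((lenS_le hn (mem_conjClass_self _)).trans h1)
  refine (zpow_mem_superSummit hn hd hr hβ.1 ((prefix_iff_le_infimum hn).2 ?_) m).1
  have h3 := exponentSum_le_supremum hn β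
  rw [exponentSum_of_mem_conjClass hβ.1, exponentSum_zpow, exponentSum_eps hn] at h3
  have hn' : (2 : ℤ) ≤ n := by exact_mod_cast hn
  -- `nd > d(n-1)` excludes `sup ≤ d`; with length at most 1 this gives `inf ≥ d`.
  have h4 : d < supremum β := by
    by_contra! hle
    nlinarith
  rw [len] at h2
  omega

end Periodic

end DualBraid

/-! ### The proposition. -/

theorem proposition3p3 (n : ℕ) (hn : 2 ≤ n) (k d p q : ℤ)
    (hd : d = (Int.gcd k ((n : ℤ) - 1) : ℤ))
    (hpq : ((n : ℤ) - 1) * p + k * q = d) :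
    -- the maps are well defined between the conjugacy classes and mutually inverse
    Set.MapsTo (DualBraid.fMap k d)
      (DualBraid.conjClass (DualBraid.eps n ^ d)) (DualBraid.conjClass (DualBraid.eps n ^ k)) ∧
    Set.MapsTo (DualBraid.gMap p q)
      (DualBraid.conjClass (DualBraid.eps n ^ k)) (DualBraid.conjClass (DualBraid.eps n ^ d)) ∧
    Set.InvOn (DualBraid.gMap p q) (DualBraid.fMap k d)
      (DualBraid.conjClass (DualBraid.eps n ^ d)) (DualBraid.conjClass (DualBraid.eps n ^ k)) ∧
    -- they restrict to bijections between the stable super summit sets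
    Set.BijOn (DualBraid.fMap k d)
      (DualBraid.stableSuperSummit (DualBraid.eps n ^ d))
      (DualBraid.stableSuperSummit (DualBraid.eps n ^ k)) ∧
    Set.BijOn (DualBraid.gMap p q)
      (DualBraid.stableSuperSummit (DualBraid.eps n ^ k))
      (DualBraid.stableSuperSummit (DualBraid.eps n ^ d)) ∧
    -- the sets being counted are finite, and their sizes compare as follows
    (DualBraid.superSummit (DualBraid.eps n ^ d)).Finite ∧
    (DualBraid.superSummit (DualBraid.eps n ^ k)).Finite ∧
    (DualBraid.superSummit (DualBraid.eps n ^ d)).ncard =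
      (DualBraid.stableSuperSummit (DualBraid.eps n ^ d)).ncard ∧
    (DualBraid.stableSuperSummit (DualBraid.eps n ^ d)).ncard =
      (DualBraid.stableSuperSummit (DualBraid.eps n ^ k)).ncard ∧
    (DualBraid.stableSuperSummit (DualBraid.eps n ^ k)).ncard ≤
      (DualBraid.superSummit (DualBraid.eps n ^ k)).ncard := by
  have hn' : (2 : ℤ) ≤ n := by exact_mod_cast hn
  have hd0 : 0 < d := by
    rw [hd]; exact_mod_cast Int.gcd_pos_of_ne_zero_right k (show (n : ℤ) - 1 ≠ 0 by omega)
  obtain ⟨r, hr⟩ : d ∣ (n : ℤ) - 1 := hd ▸ Int.gcd_dvd_right k _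
  obtain ⟨l, hl⟩ : d ∣ k := hd ▸ Int.gcd_dvd_left k _
  have hkd : k / d = l := by rw [hl, Int.mul_ediv_cancel_left _ hd0.ne']
  have hg : ∀ m : ℤ, (DualBraid.eps n ^ d) ^ m =
      DualBraid.delta n ^ ((n : ℤ) * (p * m)) * (DualBraid.eps n ^ k) ^ (q * m) := fun m => by
    rw [← DualBraid.eps_zpow_eq hn, ← zpow_mul, ← zpow_mul, ← zpow_add, ← hpq]
    congr 1; ring
  have hgpow : ∀ (β : DualBraid.BraidGroup n) (m : ℤ), DualBraid.gMap p q β ^ m =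
      DualBraid.delta n ^ ((n : ℤ) * (p * m)) * β ^ (q * m) := fun β m => by
    rw [DualBraid.gMap, (DualBraid.delta_zpow_commute hn p _).mul_zpow, ← zpow_mul, ← zpow_mul,
      mul_assoc]
  have hf : ∀ m : ℤ, (DualBraid.eps n ^ k) ^ m = (DualBraid.eps n ^ d) ^ (l * m) := fun m => by
    rw [← zpow_mul, ← zpow_mul, hl, mul_assoc]
  have hfpow : ∀ (β : DualBraid.BraidGroup n) (m : ℤ), DualBraid.fMap k d β ^ m = β ^ (l * m) :=
    fun β m => by rw [DualBraid.fMap, hkd, zpow_mul]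
  have hfmaps : Set.MapsTo (DualBraid.fMap k d)
      (DualBraid.conjClass (DualBraid.eps n ^ d))
      (DualBraid.conjClass (DualBraid.eps n ^ k)) := fun β hβ => by
    have := DualBraid.zpow_mem_conjClass hβ (l * 1)
    rwa [← hf, ← hfpow, zpow_one, zpow_one] at this
  have hgmaps : Set.MapsTo (DualBraid.gMap p q)
      (DualBraid.conjClass (DualBraid.eps n ^ k))
      (DualBraid.conjClass (DualBraid.eps n ^ d)) := fun β hβ => by
    have := DualBraid.delta_zpow_mul_mem_conjClass hn (p * 1)
      (DualBraid.zpow_mem_conjClass hβ (q * 1))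
    rwa [← hg, ← hgpow, zpow_one, zpow_one] at this
  have hfconj : ∀ γ : DualBraid.BraidGroup n,
      DualBraid.fMap k d (γ⁻¹ * DualBraid.eps n ^ d * γ) = γ⁻¹ * DualBraid.eps n ^ k * γ := by
    intro γ
    have h := conj_zpow (i := l) (a := γ⁻¹) (b := DualBraid.eps n ^ d)
    rw [inv_inv] at h
    rw [DualBraid.fMap, hkd, h, ← zpow_mul, ← hl]
  have hgconj : ∀ γ : DualBraid.BraidGroup n,
      DualBraid.gMap p q (γ⁻¹ * DualBraid.eps n ^ k * γ) = γ⁻¹ * DualBraid.eps n ^ d * γ := by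
    intro γ
    have h := conj_zpow (i := q) (a := γ⁻¹) (b := DualBraid.eps n ^ k)
    have h1 := hg 1
    rw [mul_one, mul_one, zpow_one] at h1
    rw [inv_inv] at h
    rw [DualBraid.gMap, h, h1, ← mul_assoc, ← mul_assoc, ← mul_assoc,
      (DualBraid.delta_zpow_commute hn p γ⁻¹).eq]
  have hinv : Set.InvOn (DualBraid.gMap p q) (DualBraid.fMap k d)
      (DualBraid.conjClass (DualBraid.eps n ^ d))
      (DualBraid.conjClass (DualBraid.eps n ^ k)) := by
    constructor
    · rintro _ ⟨γ, rfl⟩; rw [hfconj, hgconj]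
    · rintro _ ⟨γ, rfl⟩; rw [hgconj, hfconj]
  have hfst : Set.MapsTo (DualBraid.fMap k d)
      (DualBraid.stableSuperSummit (DualBraid.eps n ^ d))
      -- Stability of `β` is used at the exponents `lm`, `l = k/d`; membership of `f(β)` itself in
      -- the super summit set is the case `m = 1`.
      (DualBraid.stableSuperSummit (DualBraid.eps n ^ k)) := fun β hβ => by
    have h : ∀ m : ℤ, DualBraid.fMap k d β ^ m ∈
        DualBraid.superSummit ((DualBraid.eps n ^ k) ^ m) := fun m => by
      rw [hf, hfpow]; exact hβ.2 _
    exact ⟨by simpa using h 1, h⟩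
  have hgst : Set.MapsTo (DualBraid.gMap p q)
      (DualBraid.stableSuperSummit (DualBraid.eps n ^ k))
      (DualBraid.stableSuperSummit (DualBraid.eps n ^ d)) := fun β hβ => by
    have h : ∀ m : ℤ, DualBraid.gMap p q β ^ m ∈
        DualBraid.superSummit ((DualBraid.eps n ^ d) ^ m) := fun m => by
      rw [hg, hgpow]; exact DualBraid.delta_zpow_mul_mem_superSummit hn _ (hβ.2 _)
    exact ⟨by simpa using h 1, h⟩
  have hinvst : Set.InvOn (DualBraid.gMap p q) (DualBraid.fMap k d)
      (DualBraid.stableSuperSummit (DualBraid.eps n ^ d))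
      (DualBraid.stableSuperSummit (DualBraid.eps n ^ k)) :=
    hinv.mono (fun _ h => h.1.1) (fun _ h => h.1.1)
  have hbij := hinvst.bijOn hfst hgst
  refine ⟨hfmaps, hgmaps, hinv, hbij, hinvst.symm.bijOn hgst hfst,
    DualBraid.superSummit_finite hn _, DualBraid.superSummit_finite hn _,
    congrArg Set.ncard (DualBraid.superSummit_eps_eq_stable hn hd0 hr.symm), ?_,
    Set.ncard_le_ncard (fun _ h => h.1) (DualBraid.superSummit_finite hn _)⟩
  rw [← hbij.image_eq, hbij.injOn.ncard_image]
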